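/- A \emph{polytope} $P$ is the convex hull of a finite (possibly empty) set of points in a finite dimensional real vector space $E_P$. An \emph{affine map} $P\to Q$ between polytopes is a map of sets that is the restriction of an affine map $E_P\to E_Q$ between the ambient vector spaces. Let $\mathrm{Pol}$ be the category of polytopes and affine maps. For polytopes $P,Q$ put $$P\otimes Q=\mathrm{conv}\{(x\otimes y,x,y)\mid x\in P,\ y\in Q\}\subset (E_P\otimes E_Q)\oplus E_P\oplus E_Q,$$ write $x\boxtimes y=(x\otimes y,x,y)\in P\otimes Q$ for $x\in P$, $y\in Q$, let $\{*\}$ be the one-point polytope, and let $\mathrm{Hom}(P,Q)$ be the set of affine maps $P\to Q$, viewed as a subset of the finite dimensional real vector space of affine maps $P\to E_Q$ (with pointwise operations). Then every $\mathrm{Hom}(P,Q)$ is a polytope (the hom-polytope), and $\mathrm{Pol}$ is a symmetric closed monoidal category with tensor product $P\otimes Q$, unit object $\{*\}$ and internal hom $\mathrm{Hom}(P,Q)$. The structure is given by \begin{itemize} \item $(f\otimes g)(x\boxtimes y)=f(x)\boxtimes g(y)$ for affine maps $f,g$; \item associator $(P\otimes Q)\otimes R\to P\otimes(Q\otimes R)$,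 $(x\boxtimes y)\boxtimes z\mapsto x\boxtimes(y\boxtimes z)$; \item unitors $\{*\}\otimes P\to P$, $*\boxtimes x\mapsto x$, and $P\otimes\{*\}\to P$, $x\boxtimes *\mapsto x$; \item symmetry $P\otimes Q\to Q\otimes P$, $x\boxtimes y\mapsto y\boxtimes x$; \item for each $P$, the functor $\mathrm{Hom}(P,-)$, with $\mathrm{Hom}(P,g)(f)=g\circ f$, is right adjoint to $P\otimes-$, with counit $P\otimes\mathrm{Hom}(P,Q)\to Q$, $x\boxtimes f\mapsto f(x)$. \end{itemize} Moreover, $\mathrm{Pol}$ is enriched over this monoidal category: there is a $\mathrm{Pol}$-enriched category whose objects are the polytopes, whose hom-objects are the hom-polytopes $\mathrm{Hom}(P,Q)$, whose composition $\mathrm{Hom}(P,Q)\otimes\mathrm{Hom}(Q,R)\to\mathrm{Hom}(P,R)$ is $f\boxtimes g\mapsto g\circ f$, whose identities $\{*\}\to\mathrm{Hom}(P,P)$ are $*\mapsto\mathrm{id}_P$, and whose underlying ordinary category is $\mathrm{Pol}$, an affine map $f:P\to Q$ corresponding to the morphism $\{*\}\to\mathrm{Hom}(P,Q)$, $*\mapsto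 f$. -/

import Mathlib

open CategoryTheory MonoidalCategory
open scoped TensorProduct

universe u

/-- A (convex) polytope in a real vector space: the convex hull of finitely many points. -/
def IsPolytope {E : Type*} [AddCommGroup E] [Module ℝ E] (S : Set E) : Prop :=
  ∃ s : Set E, s.Finite ∧ convexHull ℝ s = S

/-- An object of the category of polytopes: a finite dimensional real vector space together with
a polytope in it. -/
structure Pol : Type (u + 1) where
  /-- the ambient vector space -/
  E : Type u
  [addCommGroup : AddCommGroup E]
  [module : Module ℝ E]
  [finiteDimensional : FiniteDimensional ℝ E]
  /-- the underlying set of the polytope -/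
  carrier : Set E
  isPolytope : IsPolytope carrier

namespace Pol

attribute [instance] Pol.addCommGroup Pol.module Pol.finiteDimensional

instance : CoeSort Pol.{u} (Type u) := ⟨fun P => P.carrier⟩

/-- An affine map between polytopes: a map which is the restriction of an affine map between the
ambient vector spaces. -/
@[ext]
structure Hom (P Q : Pol.{u}) : Type u where
  toFun : P → Q
  affine : ∃ g : P.E →ᵃ[ℝ] Q.E, ∀ x : P, g x.1 = (toFun x).1

/-- The category of polytopes and affine maps. -/
instance : Category.{u} Pol.{u} where
  Hom := Hom
  id P := ⟨fun x => x, AffineMap.id ℝ P.E, fun _ => rfl⟩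
  comp f g := ⟨fun x => g.toFun (f.toFun x), by
    obtain ⟨a, ha⟩ := f.affine
    obtain ⟨b, hb⟩ := g.affine
    exact ⟨b.comp a, fun x => by rw [AffineMap.comp_apply, ha, hb]⟩⟩

/-- The one-point polytope `{*}`. -/
def point : Pol.{u} where
  E := PUnit.{u + 1}
  carrier := Set.univ
  isPolytope := ⟨Set.univ, Set.finite_univ, convexHull_univ⟩

/-- The unique point of the one-point polytope. -/
def star : point.{u} := ⟨PUnit.unit, trivial⟩

/-- The generating set `{(x ⊗ y, x, y) | x ∈ P, y ∈ Q}` of the tensor product of polytopes. -/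
def tensorGenerators (P Q : Pol.{u}) : Set ((P.E ⊗[ℝ] Q.E) × P.E × Q.E) :=
  {z | ∃ x ∈ P.carrier, ∃ y ∈ Q.carrier, z = (x ⊗ₜ[ℝ] y, x, y)}

theorem isPolytope_convexHull_tensorGenerators (P Q : Pol.{u}) :
    IsPolytope (convexHull ℝ (tensorGenerators P Q)) := by
  obtain ⟨s, hs, hsP⟩ := P.isPolytope
  obtain ⟨t, ht, htQ⟩ := Q.isPolytope
  let φ : P.E × Q.E → (P.E ⊗[ℝ] Q.E) × P.E × Q.E := fun p => (p.1 ⊗ₜ[ℝ] p.2, p.1, p.2)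
  have hK : Convex ℝ (convexHull ℝ (φ '' (s ×ˢ t))) := convex_convexHull ℝ _
  have h1 : ∀ x ∈ P.carrier, ∀ y ∈ t, φ (x, y) ∈ convexHull ℝ (φ '' (s ×ˢ t)) := by
    intro x hx y hy
    rw [← hsP] at hx
    refine convexHull_min (t := {x | φ (x, y) ∈ convexHull ℝ (φ '' (s ×ˢ t))}) ?_ ?_ hx
    · exact fun x hx => subset_convexHull ℝ _ ⟨(x, y), ⟨hx, hy⟩, rfl⟩
    · intro x hx x' hx' a b ha hb hab
      have key : φ (a • x + b • x', y) = a • φ (x, y) + b • φ (x', y) := by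
        simp [φ, TensorProduct.add_tmul, TensorProduct.smul_tmul', ← add_smul, hab]
      have := hK hx hx' ha hb hab
      rwa [← key] at this
  have h2 : ∀ x ∈ P.carrier, ∀ y ∈ Q.carrier, φ (x, y) ∈ convexHull ℝ (φ '' (s ×ˢ t)) := by
    intro x hx y hy
    rw [← htQ] at hy
    refine convexHull_min (t := {y | φ (x, y) ∈ convexHull ℝ (φ '' (s ×ˢ t))}) ?_ ?_ hy
    · exact fun y hy => h1 x hx y hy
    · intro y hy y' hy' a b ha hb hab
      have key : φ (x, a • y + b • y') = a • φ (x, y) + b • φ (x, y') := by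
        simp [φ, TensorProduct.tmul_add, TensorProduct.tmul_smul, ← add_smul, hab]
      have := hK hy hy' ha hb hab
      rwa [← key] at this
  refine ⟨φ '' (s ×ˢ t), (hs.prod ht).image φ, Set.Subset.antisymm ?_ ?_⟩
  · refine convexHull_mono ?_
    rintro _ ⟨⟨x, y⟩, ⟨hx, hy⟩, rfl⟩
    exact ⟨x, hsP ▸ subset_convexHull ℝ s hx, y, htQ ▸ subset_convexHull ℝ t hy, rfl⟩
  · refine convexHull_min ?_ hK
    rintro _ ⟨x, hx, y, hy, rfl⟩
    exact h2 x hx y hy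

/-- The tensor product `P ⊗ Q = conv {(x ⊗ y, x, y) | x ∈ P, y ∈ Q}` of polytopes. -/
def tensor (P Q : Pol.{u}) : Pol.{u} where
  E := (P.E ⊗[ℝ] Q.E) × P.E × Q.E
  carrier := convexHull ℝ (tensorGenerators P Q)
  isPolytope := isPolytope_convexHull_tensorGenerators P Q

/-- The universal bi-affine map `P × Q → P ⊗ Q`, `(x, y) ↦ (x ⊗ y, x, y)`. -/
def tmul {P Q : Pol.{u}} (x : P) (y : Q) : tensor P Q :=
  ⟨(x.1 ⊗ₜ[ℝ] y.1, x.1, y.1), by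
    exact subset_convexHull ℝ (tensorGenerators P Q) ⟨x.1, x.2, y.1, y.2, rfl⟩⟩

/-- The vector space (under pointwise operations) of all affine maps from the polytope `P` to the
vector space `F`, i.e. of the restrictions to `P` of affine maps from the ambient space to `F`. -/
def affineMaps (P : Pol.{u}) (F : Type u) [AddCommGroup F] [Module ℝ F] :
    Submodule ℝ (P → F) where
  carrier := {φ | ∃ g : P.E →ᵃ[ℝ] F, ∀ x : P, g x.1 = φ x}
  add_mem' := by
    rintro φ ψ ⟨g, hg⟩ ⟨h, hh⟩
    exact ⟨g + h, fun x => by simp [hg, hh]⟩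
  zero_mem' := ⟨0, fun x => by simp⟩
  smul_mem' := by
    rintro c φ ⟨g, hg⟩
    exact ⟨c • g, fun x => by simp [hg]⟩

instance (P : Pol.{u}) (F : Type u) [AddCommGroup F] [Module ℝ F] [FiniteDimensional ℝ F] :
    FiniteDimensional ℝ (affineMaps P F) := by
  let r : (P.E →ᵃ[ℝ] F) →ₗ[ℝ] affineMaps P F :=
    { toFun := fun g => ⟨fun x => g x.1, g, fun _ => rfl⟩
      map_add' := fun _ _ => rfl
      map_smul' := fun _ _ => rfl }
  refine Module.Finite.of_surjective r ?_
  rintro ⟨φ, g, hg⟩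
  exact ⟨g, Subtype.ext (funext hg)⟩

/-- The set of affine maps `P → Q`, as a subset of the vector space of affine maps from `P` to the
ambient space of `Q`. -/
def homSet (P Q : Pol.{u}) : Set (affineMaps P Q.E) :=
  {φ | ∀ x : P, φ.1 x ∈ Q.carrier}

/-- The hom-polytope `Hom(P, Q)`, given that the set of affine maps `P → Q` is a polytope. -/
def homPolytope (P Q : Pol.{u}) (h : IsPolytope (homSet P Q)) : Pol.{u} where
  E := affineMaps P Q.E
  carrier := homSet P Q
  isPolytope := h

/-- An affine map `P → Q`, regarded as a point of the hom-polytope `Hom(P, Q)`. -/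
def toPoint {P Q : Pol.{u}} (h : IsPolytope (homSet P Q)) (f : P ⟶ Q) : homPolytope P Q h :=
  ⟨⟨fun x => (f.toFun x).1, f.affine⟩, fun x => (f.toFun x).2⟩

theorem toPoint_bijective {P Q : Pol.{u}} (h : IsPolytope (homSet P Q)) :
    Function.Bijective (toPoint h : (P ⟶ Q) → homPolytope P Q h) := by
  constructor
  · intro f g hfg
    refine Hom.ext (funext fun x => Subtype.ext ?_)
    exact congrFun (congrArg (fun φ => φ.1.1) hfg) x
  · rintro ⟨⟨φ, hφ⟩, hQ⟩
    exact ⟨⟨fun x => ⟨φ x, hQ x⟩, hφ⟩, rfl⟩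

/-- The point of `Q` corresponding to a point `x` of `P` when `P` and `Q` are the same polytope. -/
def cast {P Q : Pol.{u}} (h : P = Q) (x : P) : Q := (eqToHom h).toFun x

end Pol

/-! Two facts carry the theorem. First, a linear section of a polytope is a polytope
(`IsPolytope.inter_ker`, `IsPolytope.inter_submodule`). An affine map on `P` is determined by its
values on a finite generating set `s`, and it lands in `Q` as soon as those values do. So evaluation
embeds the space of affine maps linearly in `Q.E ^ s`, with `Hom(P, Q)` the preimage of the polytope
`Q ^ s`.

Second, `P ⊗ Q` represents bi-affine maps. A map preserving convex combinations extends to an affine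
map of the ambient spaces (`PreservesConvex.exists_affineMap`), so affineness can be tested on the
polytope alone. A bi-affine map splits into a bilinear part, two linear parts and a constant, hence
factors through `(x ⊗ y, x, y)` (`lift`). As these points generate, the factorization is unique
(`tensor_hom_ext`).

All structure maps, evaluation and composition included, then come from bi-affine formulas, and
every coherence law is checked on pure tensors, where both sides are visibly equal. -/

/-! ### Linear sections of polytopes. -/

theorem Finset.sum_eq_sum_filter_sign {ι N : Type*} [AddCommMonoid N] (s : Finset ι) (f : ι → ℝ)
    (H : ι → N) : ∑ i ∈ s, H i =
      ∑ i ∈ s with f i = 0, H i + (∑ i ∈ s with 0 < f i, H i + ∑ i ∈ s with f i < 0, H i) := by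
  rw [Finset.sum_filter, Finset.sum_filter, Finset.sum_filter, ← Finset.sum_add_distrib,
    ← Finset.sum_add_distrib]
  refine Finset.sum_congr rfl fun i _ => ?_
  rcases lt_trichotomy (f i) 0 with h | h | h
  · simp [h, h.ne, h.not_gt]
  · simp [h]
  · simp [h, h.ne', h.not_gt]

/-- The positive and negative parts of `∑ w i * f i` have the same mass `A`, so each positive index
can be coupled with each negative one with weight `w i * w j / A`. Summing a coupling over one index
restores the weight of the other. This rewrites a convex combination lying on a hyperplane in terms
of the points where segments cross it. -/
theorem sum_smul_eq_sum_crossing {ι M : Type*} [AddCommGroup M] [Module ℝ M] (s : Finset ι)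
    (w f : ι → ℝ) (hw : ∀ i ∈ s, 0 ≤ w i) (hf : ∑ i ∈ s, w i * f i = 0) :
    ∃ A : ℝ, 0 ≤ A ∧ ∀ G : ι → M, ∑ i ∈ s, w i • G i = ∑ i ∈ s with f i = 0, w i • G i +
      ∑ q ∈ (s.filter (0 < f ·)) ×ˢ (s.filter (f · < 0)),
        (w q.1 * w q.2 / A) • (f q.1 • G q.2 - f q.2 • G q.1) := by
  set A := ∑ i ∈ s with 0 < f i, w i * f i with hA
  have hA' : ∑ i ∈ s with f i < 0, w i * f i = -A := by
    have h := s.sum_eq_sum_filter_sign f fun i => w i * f i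
    have h0 : ∑ i ∈ s with f i = 0, w i * f i = 0 :=
      Finset.sum_eq_zero fun i hi => by simp [(Finset.mem_filter.1 hi).2]
    rw [hf, h0] at h
    linarith
  have hpos : ∀ i ∈ s.filter (0 < f ·), 0 ≤ w i * f i := fun i hi =>
    mul_nonneg (hw i (Finset.mem_filter.1 hi).1) (Finset.mem_filter.1 hi).2.le
  have hneg : ∀ i ∈ s.filter (f · < 0), w i * f i ≤ 0 := fun i hi =>
    mul_nonpos_of_nonneg_of_nonpos (hw i (Finset.mem_filter.1 hi).1) (Finset.mem_filter.1 hi).2.le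
  -- If `A = 0`, every weight off the hyperplane vanishes, so the default value `A / A = 0` does no
  -- harm.
  have hp : ∀ i ∈ s.filter (0 < f ·), w i * (A / A) = w i := by
    intro i hi
    by_cases h : A = 0
    · have := (Finset.sum_eq_zero_iff_of_nonneg hpos).1 (hA.symm.trans h) i hi
      rcases mul_eq_zero.1 this with h' | h'
      · simp [h']
      · exact absurd h' (Finset.mem_filter.1 hi).2.ne'
    · rw [div_self h, mul_one]
  have hn : ∀ i ∈ s.filter (f · < 0), w i * (A / A) = w i := by
    intro i hi
    by_cases h : A = 0
    · have := (Finset.sum_eq_zero_iff_of_nonpos hneg).1 (by rw [hA', h, neg_zero]) i hi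
      rcases mul_eq_zero.1 this with h' | h'
      · simp [h']
      · exact absurd h' (Finset.mem_filter.1 hi).2.ne
    · rw [div_self h, mul_one]
  refine ⟨A, Finset.sum_nonneg hpos, fun G => ?_⟩
  rw [s.sum_eq_sum_filter_sign f, add_right_inj]
  simp only [smul_sub, smul_smul, Finset.sum_sub_distrib]
  rw [Finset.sum_product_right, Finset.sum_product]
  simp only [← Finset.sum_smul]
  rw [add_comm, sub_eq_add_neg, ← Finset.sum_neg_distrib]
  congr 1
  · refine Finset.sum_congr rfl fun i hi => ?_
    congr 1
    calc w i = w i * A / A := by rw [mul_div_assoc, hn i hi]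
      _ = _ := by
        rw [hA, Finset.mul_sum, Finset.sum_div]
        exact Finset.sum_congr rfl fun j _ => by ring
  · refine Finset.sum_congr rfl fun i hi => ?_
    rw [← neg_smul]
    congr 1
    calc w i = -(w i * (-A) / A) := by rw [mul_neg, neg_div, neg_neg, mul_div_assoc, hp i hi]
      _ = _ := by
        rw [← hA', Finset.mul_sum, Finset.sum_div]
        congr 1
        exact Finset.sum_congr rfl fun j _ => by ring

namespace IsPolytope

variable {E F : Type*} [AddCommGroup E] [Module ℝ E] [AddCommGroup F] [Module ℝ F]

theorem convex {S : Set E} (hS : IsPolytope S) : Convex ℝ S := by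
  obtain ⟨s, -, rfl⟩ := hS
  exact convex_convexHull ℝ s

theorem image {S : Set E} (hS : IsPolytope S) (f : E →ₗ[ℝ] F) : IsPolytope (f '' S) := by
  obtain ⟨s, hs, rfl⟩ := hS
  exact ⟨f '' s, hs.image f, (f.image_convexHull s).symm⟩

theorem pi {ι : Type*} [Finite ι] {S : Set E} (hS : IsPolytope S) :
    IsPolytope (Set.univ.pi fun _ : ι => S) := by
  obtain ⟨s, hs, rfl⟩ := hS
  exact ⟨Set.univ.pi fun _ => s, Set.Finite.pi fun _ => hs, by rw [convexHull_pi]⟩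

/-- A polytope meets a linear hyperplane in the convex hull of its vertices on the hyperplane and
of the points where the segments between vertices on opposite sides cross the hyperplane. -/
theorem inter_ker {S : Set E} (hS : IsPolytope S) (f : E →ₗ[ℝ] ℝ) :
    IsPolytope (S ∩ {x | f x = 0}) := by
  obtain ⟨s, hs, rfl⟩ := hS
  lift s to Finset E using hs
  let c : E × E → E := fun q => (f q.1 - f q.2)⁻¹ • (f q.1 • q.2 - f q.2 • q.1)
  let T : Finset (E × E) := (s.filter (0 < f ·)) ×ˢ (s.filter (f · < 0))
  have hT : ∀ q ∈ T, q.1 ∈ s ∧ q.2 ∈ s ∧ 0 < f q.1 ∧ f q.2 < 0 := by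
    intro q hq
    simp only [T, Finset.mem_product, Finset.mem_filter] at hq
    tauto
  refine ⟨↑(s.filter (f · = 0)) ∪ c '' T, (Finset.finite_toSet _).union
    ((Finset.finite_toSet _).image _), Set.Subset.antisymm (convexHull_min ?_ ?_) ?_⟩
  · rintro x (hx | ⟨q, hq, rfl⟩)
    · have := Finset.mem_filter.1 (Finset.mem_coe.1 hx)
      exact ⟨subset_convexHull ℝ _ this.1, this.2⟩
    · obtain ⟨h1, h2, h3, h4⟩ := hT q hq
      have h : 0 < f q.1 - f q.2 := by linarith
      constructor
      · have : c q = (f q.1 / (f q.1 - f q.2)) • q.2 + (-f q.2 / (f q.1 - f q.2)) • q.1 := by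
          simp only [c]
          module
        rw [this]
        refine convex_convexHull ℝ _ (subset_convexHull ℝ _ h2) (subset_convexHull ℝ _ h1)
          (div_nonneg h3.le h.le) (div_nonneg (by linarith) h.le) ?_
        field_simp
        ring
      · simp only [c, Set.mem_ofPred_eq, map_smul, map_sub, smul_eq_mul]
        ring
  · exact (convex_convexHull ℝ _).inter (convex_hyperplane f.isLinear 0)
  · rintro x ⟨hx, hfx⟩
    obtain ⟨w, hw, hw1, rfl⟩ := Finset.mem_convexHull'.1 hx
    have hf : ∑ i ∈ s, w i * f i = 0 := by simpa using hfx
    -- Applied to `(v, 1)`, the identity gives both the new expression of the point and the fact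
    -- that the new weights sum to one.
    obtain ⟨A, hA, key⟩ := sum_smul_eq_sum_crossing (M := E × ℝ) s w f hw hf
    have key := key fun v => (v, 1)
    have keyE := congrArg Prod.fst key
    have keyR := congrArg Prod.snd key
    simp only [Prod.fst_sum, Prod.snd_sum, Prod.fst_add, Prod.snd_add, Prod.smul_fst,
      Prod.smul_snd, Prod.fst_sub, Prod.snd_sub, smul_eq_mul, mul_one, hw1] at keyE keyR
    let I : Finset (E ⊕ E × E) := (s.filter (f · = 0)).disjSum T
    -- The factor `f q.1 - f q.2` cancels the normalization in the crossing point `c q`.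
    let W : E ⊕ E × E → ℝ := Sum.elim w fun q => w q.1 * w q.2 / A * (f q.1 - f q.2)
    have hmem : ∑ i ∈ I, W i • Sum.elim id c i ∈
        convexHull ℝ (↑(s.filter (f · = 0)) ∪ c '' T) := by
      refine (convex_convexHull ℝ _).sum_mem ?_ ?_ ?_
      · rintro (v | q) hi
        · rw [Finset.inl_mem_disjSum] at hi
          exact hw v (Finset.mem_filter.1 hi).1
        · rw [Finset.inr_mem_disjSum] at hi
          obtain ⟨h1, h2, h3, h4⟩ := hT q hi
          exact mul_nonneg (div_nonneg (mul_nonneg (hw _ h1) (hw _ h2)) hA) (by linarith)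
      · rw [Finset.sum_disjSum]
        exact keyR.symm
      · rintro (v | q) hi
        · rw [Finset.inl_mem_disjSum] at hi
          exact subset_convexHull ℝ _ (Or.inl hi)
        · rw [Finset.inr_mem_disjSum] at hi
          exact subset_convexHull ℝ _ (Or.inr ⟨q, hi, rfl⟩)
    rw [Finset.sum_disjSum] at hmem
    have hc : ∀ q ∈ T, (w q.1 * w q.2 / A) • (f q.1 • q.2 - f q.2 • q.1) = W (Sum.inr q) • c q := by
      intro q hq
      obtain ⟨h1, h2, h3, h4⟩ := hT q hq
      have h : f q.1 - f q.2 ≠ 0 := by linarith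
      simp only [W, c, Sum.elim_inr]
      rw [smul_smul, mul_assoc, mul_inv_cancel₀ h, mul_one]
    rw [keyE, Finset.sum_congr rfl hc]
    exact hmem

/-- Coordinates on `E ⧸ L` exhibit `L` as a finite intersection of kernels of functionals, which are
cut out one at a time. -/
theorem inter_submodule [FiniteDimensional ℝ E] {S : Set E} (hS : IsPolytope S)
    (L : Submodule ℝ E) : IsPolytope (S ∩ L) := by
  let b := Module.finBasis ℝ (E ⧸ L)
  let f : Fin (Module.finrank ℝ (E ⧸ L)) → E →ₗ[ℝ] ℝ := fun i => b.coord i ∘ₗ L.mkQ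
  have key : ∀ I : Finset (Fin (Module.finrank ℝ (E ⧸ L))),
      IsPolytope (S ∩ {x | ∀ i ∈ I, f i x = 0}) := by
    intro I
    induction I using Finset.induction_on with
    | empty => simpa using hS
    | insert i I _ ih =>
      convert ih.inter_ker (f i) using 1
      ext x
      simp only [Set.mem_inter_iff, Set.mem_ofPred_eq, Finset.forall_mem_insert]
      tauto
  convert key Finset.univ using 2
  ext x
  have : x ∈ L ↔ L.mkQ x = 0 := by simp
  rw [SetLike.mem_coe, this, ← b.forall_coord_eq_zero_iff]
  simp [f]

/-- A linear left inverse of `f` carries the section of `S` by the range of `f` onto the preimage.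
-/
theorem preimage [FiniteDimensional ℝ F] {S : Set F} (hS : IsPolytope S) (f : E →ₗ[ℝ] F)
    (hf : Function.Injective f) : IsPolytope (f ⁻¹' S) := by
  obtain ⟨g, hg⟩ := f.exists_leftInverse_of_injective (LinearMap.ker_eq_bot.2 hf)
  have hgf : ∀ x, g (f x) = x := fun x => LinearMap.congr_fun hg x
  convert (hS.inter_submodule (LinearMap.range f)).image g using 1
  ext x
  constructor
  · exact fun hx => ⟨f x, ⟨hx, x, rfl⟩, hgf x⟩
  · rintro ⟨_, ⟨hy, z, rfl⟩, rfl⟩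
    rwa [hgf]

end IsPolytope

/-! ### Hom-polytopes. -/

namespace Pol

theorem isPolytope_homSet (P Q : Pol.{u}) : IsPolytope (homSet P Q) := by
  obtain ⟨s, hs, hsP⟩ := P.isPolytope
  have : Finite s := hs
  have hmem : ∀ v ∈ s, v ∈ P.carrier := fun v hv => hsP ▸ subset_convexHull ℝ s hv
  let ev : affineMaps P Q.E →ₗ[ℝ] (s → Q.E) :=
    { toFun := fun φ v => φ.1 ⟨v, hmem v v.2⟩
      map_add' := fun _ _ => rfl
      map_smul' := fun _ _ => rfl }
  -- The locus where two affine maps agree is convex, so agreement on `s` spreads to its hull.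
  have hev : Function.Injective ev := by
    rintro ⟨φ, g, hg⟩ ⟨ψ, h, hh⟩ H
    refine Subtype.ext (funext fun x => ?_)
    have hx : x.1 ∈ convexHull ℝ s := by rw [hsP]; exact x.2
    have hsub : s ⊆ {y | g y = h y} := fun v hv => by
      have := congrFun H ⟨v, hv⟩
      exact (hg ⟨v, hmem v hv⟩).trans (this.trans (hh ⟨v, hmem v hv⟩).symm)
    have hconv : Convex ℝ {y | g y = h y} := by
      intro y hy z hz a b _ _ hab
      rw [Set.mem_ofPred_eq] at *
      rw [Convex.combo_affine_apply hab, Convex.combo_affine_apply hab, hy, hz]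
    have := convexHull_min hsub hconv hx
    exact (hg x).symm.trans (this.trans (hh x))
  convert (Q.isPolytope.pi (ι := s)).preimage ev hev using 1
  ext φ
  constructor
  · exact fun hφ v _ => hφ ⟨v, hmem v v.2⟩
  · intro hφ x
    obtain ⟨g, hg⟩ := φ.2
    rw [← hg]
    have hx : x.1 ∈ convexHull ℝ s := by rw [hsP]; exact x.2
    refine convexHull_min (t := g ⁻¹' Q.carrier) ?_ (Q.isPolytope.convex.affine_preimage g) hx
    intro v hv
    have := hφ ⟨v, hv⟩ trivial
    rw [Set.mem_preimage, hg ⟨v, hmem v hv⟩]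
    exact this

end Pol

/-! ### Affine maps as maps preserving convex combinations. -/

namespace Pol

theorem convex_carrier (P : Pol.{u}) : Convex ℝ P.carrier := P.isPolytope.convex

section

variable {P Q R S : Pol.{u}} {F : Type*} [AddCommGroup F] [Module ℝ F]

/-- A map from a polytope to a vector space which preserves convex combinations. -/
def PreservesConvex (φ : P → F) : Prop :=
  ∀ ⦃x y z : P⦄ ⦃a b : ℝ⦄, 0 ≤ a → 0 ≤ b → a + b = 1 → z.1 = a • x.1 + b • y.1 →
    φ z = a • φ x + b • φ y

/-- Homogeneous form of the hypothesis: it merges two nonnegatively weighted points without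
normalizing. When the total weight is zero, any point serves. -/
theorem PreservesConvex.exists_conic_combo {φ : P → F} (hφ : PreservesConvex φ) (x y : P) {a b : ℝ}
    (ha : 0 ≤ a) (hb : 0 ≤ b) : ∃ z : P, (a + b) • z.1 = a • x.1 + b • y.1 ∧
      (a + b) • φ z = a • φ x + b • φ y := by
  by_cases h : a + b = 0
  · have ha' : a = 0 := by linarith
    have hb' : b = 0 := by linarith
    exact ⟨x, by simp [ha', hb'], by simp [ha', hb']⟩
  · have h0 : 0 ≤ a + b := by linarith
    have h1 : a / (a + b) + b / (a + b) = 1 := by field_simp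
    refine ⟨⟨_, P.convex_carrier x.2 y.2 (div_nonneg ha h0) (div_nonneg hb h0) h1⟩, ?_, ?_⟩
    · simp only [smul_add, smul_smul, mul_div_cancel₀ _ h]
    · rw [hφ (div_nonneg ha h0) (div_nonneg hb h0) h1 rfl]
      simp only [smul_add, smul_smul, mul_div_cancel₀ _ h]

/-- A map which preserves convex combinations extends to an affine map of the ambient spaces. -/
theorem PreservesConvex.exists_affineMap {φ : P → F} (hφ : PreservesConvex φ) :
    ∃ g : P.E →ᵃ[ℝ] F, ∀ x : P, g x.1 = φ x := by
  rcases isEmpty_or_nonempty P with hP | ⟨⟨p⟩⟩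
  · exact ⟨0, fun x => hP.elim x⟩
  let Φ : (P →₀ ℝ) →ₗ[ℝ] P.E × ℝ := Finsupp.linearCombination ℝ fun x : P => (x.1, 1)
  let Ψ : (P →₀ ℝ) →ₗ[ℝ] F := Finsupp.linearCombination ℝ φ
  -- Merging the positive and the negative terms of a formal combination leaves one point on each
  -- side. If `Φ c = 0`, the weights agree and, unless they vanish, so do the points; hence `Ψ c =
  -- 0`.
  have key : ∀ c, ∃ a b : ℝ, ∃ x y : P, 0 ≤ a ∧ 0 ≤ b ∧
      Φ c = (a • x.1 - b • y.1, a - b) ∧ Ψ c = a • φ x - b • φ y := by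
    intro c
    induction c using Finsupp.induction_linear with
    | zero => exact ⟨0, 0, p, p, le_rfl, le_rfl, by simp [← Prod.zero_eq_mk], by simp⟩
    | add c d hc hd =>
      obtain ⟨a, b, x, y, ha, hb, h1, h2⟩ := hc
      obtain ⟨a', b', x', y', ha', hb', h1', h2'⟩ := hd
      obtain ⟨z, hz, hz'⟩ := hφ.exists_conic_combo x x' ha ha'
      obtain ⟨w, hw, hw'⟩ := hφ.exists_conic_combo y y' hb hb'
      refine ⟨a + a', b + b', z, w, add_nonneg ha ha', add_nonneg hb hb', ?_, ?_⟩
      · rw [map_add, h1, h1', hz, hw, Prod.mk_add_mk]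
        congr 1
        · abel
        · ring
      · rw [map_add, h2, h2', hz', hw']
        abel
    | single x t =>
      have h1 : Φ (Finsupp.single x t) = (t • x.1, t) := by simp [Φ]
      have h2 : Ψ (Finsupp.single x t) = t • φ x := by simp [Ψ]
      rcases le_total 0 t with ht | ht
      · exact ⟨t, 0, x, x, ht, le_rfl, by simp [h1], by simp [h2]⟩
      · exact ⟨0, -t, x, x, le_rfl, by linarith, by simp [h1], by simp [h2]⟩
  have hker : LinearMap.ker Φ ≤ LinearMap.ker Ψ := by
    intro c hc
    obtain ⟨a, b, x, y, ha, hb, h1, h2⟩ := key c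
    rw [LinearMap.mem_ker] at hc ⊢
    rw [h1, Prod.mk_eq_zero] at hc
    obtain rfl : a = b := sub_eq_zero.1 hc.2
    rw [h2, ← smul_sub]
    rcases eq_or_ne a 0 with rfl | h
    · simp
    · rw [← smul_sub, smul_eq_zero_iff_right h, sub_eq_zero] at hc
      rw [Subtype.ext hc.1, sub_self, smul_zero]
  obtain ⟨g, hg⟩ : ∃ g : P.E × ℝ →ₗ[ℝ] F, g ∘ₗ Φ = Ψ := by
    obtain ⟨g, hg⟩ := ((LinearMap.ker Φ).liftQ Ψ hker ∘ₗ
      Φ.quotKerEquivRange.symm.toLinearMap).exists_extend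
    refine ⟨g, LinearMap.ext fun c => ?_⟩
    have h := LinearMap.congr_fun hg (Φ.quotKerEquivRange (Submodule.Quotient.mk c))
    simpa using h
  -- The extension is `x ↦ g (x, 1)`.
  refine ⟨g.toAffineMap.comp
    ((LinearMap.inl ℝ P.E ℝ).toAffineMap + AffineMap.const ℝ P.E (0, 1)), fun x => ?_⟩
  have := LinearMap.congr_fun hg (Finsupp.single x 1)
  simpa [Φ, Ψ] using this

/-- The affine map given by a map of polytopes which preserves convex combinations. -/
def homMk (φ : P → Q) (hφ : PreservesConvex fun x => (φ x).1) : P ⟶ Q :=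
  Hom.mk φ hφ.exists_affineMap

@[simp]
theorem homMk_toFun (φ : P → Q) (hφ : PreservesConvex fun x => (φ x).1) (x : P) :
    (homMk φ hφ).toFun x = φ x := rfl

@[simp]
theorem id_toFun (x : P) : Hom.toFun (𝟙 P) x = x := rfl

@[simp]
theorem comp_toFun (f : P ⟶ Q) (g : Q ⟶ R) (x : P) :
    Hom.toFun (f ≫ g) x = g.toFun (f.toFun x) := rfl

theorem hom_ext {f g : P ⟶ Q} (h : ∀ x, f.toFun x = g.toFun x) : f = g :=
  Hom.ext (funext h)

theorem preservesConvex_val : PreservesConvex fun x : P => x.1 :=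
  fun _ _ _ _ _ _ _ _ h => h

theorem PreservesConvex.comp {φ : Q → F} (hφ : PreservesConvex φ) {ψ : P → Q}
    (hψ : PreservesConvex fun x => (ψ x).1) : PreservesConvex fun x => φ (ψ x) :=
  fun _ _ _ _ _ ha hb hab h => hφ ha hb hab (hψ ha hb hab h)

theorem preservesConvex_of_affineMap {φ : P → F} (g : P.E →ᵃ[ℝ] F) (hg : ∀ x : P, g x.1 = φ x) :
    PreservesConvex φ := by
  intro x y z a b _ _ hab h
  rw [← hg, ← hg, ← hg, h, Convex.combo_affine_apply hab]

theorem preservesConvex_hom (f : P ⟶ Q) : PreservesConvex fun x => (f.toFun x).1 :=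
  preservesConvex_of_affineMap f.affine.choose f.affine.choose_spec

theorem preservesConvex_const (c : F) : PreservesConvex fun _ : P => c :=
  fun _ _ _ _ _ _ _ hab _ => (Convex.combo_self hab c).symm

theorem preservesConvex_tmul_left (y : Q) : PreservesConvex fun x : P => (tmul x y).1 := by
  intro x x' z a b _ _ hab h
  change ((z.1 ⊗ₜ[ℝ] y.1, z.1, y.1) : (P.E ⊗[ℝ] Q.E) × P.E × Q.E) =
    a • (x.1 ⊗ₜ[ℝ] y.1, x.1, y.1) + b • (x'.1 ⊗ₜ[ℝ] y.1, x'.1, y.1)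
  simp only [ h, Prod.smul_mk, Prod.mk_add_mk, Convex.combo_self hab, TensorProduct.add_tmul,
    TensorProduct.smul_tmul']

theorem preservesConvex_tmul_right (x : P) : PreservesConvex fun y : Q => (tmul x y).1 := by
  intro y y' z a b _ _ hab h
  change ((x.1 ⊗ₜ[ℝ] z.1, x.1, z.1) : (P.E ⊗[ℝ] Q.E) × P.E × Q.E) =
    a • (x.1 ⊗ₜ[ℝ] y.1, x.1, y.1) + b • (x.1 ⊗ₜ[ℝ] y'.1, x.1, y'.1)
  simp only [ h, Prod.smul_mk, Prod.mk_add_mk, Convex.combo_self hab, TensorProduct.tmul_add,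
    TensorProduct.tmul_smul]

/-- The agreement locus is convex and contains the generators of the hull. -/
theorem PreservesConvex.eq_of_tmul {φ ψ : tensor P Q → F} (hφ : PreservesConvex φ)
    (hψ : PreservesConvex ψ) (h : ∀ x y, φ (tmul x y) = ψ (tmul x y)) (w : tensor P Q) :
    φ w = ψ w := by
  obtain ⟨w, hw⟩ := w
  have hw' : w ∈ convexHull ℝ (tensorGenerators P Q) := hw
  let t : Set ((P.E ⊗[ℝ] Q.E) × P.E × Q.E) :=
    {w | ∃ h : w ∈ (tensor P Q).carrier, φ ⟨w, h⟩ = ψ ⟨w, h⟩}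
  refine (convexHull_min (t := t) ?_ ?_ hw').choose_spec
  · rintro _ ⟨x, hx, y, hy, rfl⟩
    exact ⟨(tmul ⟨x, hx⟩ ⟨y, hy⟩ : tensor P Q).2, h ⟨x, hx⟩ ⟨y, hy⟩⟩
  · rintro x ⟨hx, hx'⟩ y ⟨hy, hy'⟩ a b ha hb hab
    refine ⟨(tensor P Q).convex_carrier hx hy ha hb hab, ?_⟩
    rw [hφ (x := ⟨x, hx⟩) (y := ⟨y, hy⟩) ha hb hab rfl,
      hψ (x := ⟨x, hx⟩) (y := ⟨y, hy⟩) ha hb hab rfl, hx', hy']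

theorem tensor_hom_ext {f g : tensor P Q ⟶ R}
    (h : ∀ x y, f.toFun (tmul x y) = g.toFun (tmul x y)) : f = g :=
  hom_ext fun w => Subtype.ext <| (preservesConvex_hom f).eq_of_tmul (preservesConvex_hom g)
    (fun x y => congrArg Subtype.val (h x y)) w

theorem tensor_hom_ext_left {f g : tensor (tensor P Q) R ⟶ S}
    (h : ∀ x y z, f.toFun (tmul (tmul x y) z) = g.toFun (tmul (tmul x y) z)) : f = g :=
  tensor_hom_ext fun w z => Subtype.ext <|
    ((preservesConvex_hom f).comp (preservesConvex_tmul_left z)).eq_of_tmul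
      ((preservesConvex_hom g).comp (preservesConvex_tmul_left z))
      (fun x y => congrArg Subtype.val (h x y z)) w

theorem tensor_hom_ext_right {f g : tensor P (tensor Q R) ⟶ S}
    (h : ∀ x y z, f.toFun (tmul x (tmul y z)) = g.toFun (tmul x (tmul y z))) : f = g :=
  tensor_hom_ext fun x w => Subtype.ext <|
    ((preservesConvex_hom f).comp (preservesConvex_tmul_right x)).eq_of_tmul
      ((preservesConvex_hom g).comp (preservesConvex_tmul_right x))
      (fun y z => congrArg Subtype.val (h x y z)) w

theorem tensor_hom_ext_quadruple {T : Pol.{u}} {f g : tensor (tensor (tensor P Q) R) S ⟶ T}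
    (h : ∀ x y z w, f.toFun (tmul (tmul (tmul x y) z) w) =
      g.toFun (tmul (tmul (tmul x y) z) w)) : f = g :=
  tensor_hom_ext_left fun v z w => Subtype.ext <|
    (((preservesConvex_hom f).comp (preservesConvex_tmul_left w)).comp
      (preservesConvex_tmul_left z)).eq_of_tmul
    (((preservesConvex_hom g).comp (preservesConvex_tmul_left w)).comp
      (preservesConvex_tmul_left z))
    (fun x y => congrArg Subtype.val (h x y z w)) v

/-! ### The universal property of the tensor product. -/

/-- The curried map takes values in restrictions of affine maps to `Q` and preserves convex
combinations there, so it extends in the first variable. A linear section `σ` of restriction then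
extends it in the second. -/
theorem exists_biaffineMap (φ : P → Q → F) (h₁ : ∀ y, PreservesConvex fun x => φ x y)
    (h₂ : ∀ x, PreservesConvex (φ x)) :
    ∃ G : P.E →ᵃ[ℝ] (Q.E →ᵃ[ℝ] F), ∀ (x : P) (y : Q), G x.1 y.1 = φ x y := by
  let r : (Q.E →ᵃ[ℝ] F) →ₗ[ℝ] (Q → F) :=
    { toFun := fun g x => g x.1
      map_add' := fun _ _ => rfl
      map_smul' := fun _ _ => rfl }
  let φ' : P → LinearMap.range r := fun x =>
    ⟨φ x, (h₂ x).exists_affineMap.choose, funext (h₂ x).exists_affineMap.choose_spec⟩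
  have hφ' : PreservesConvex φ' := fun x x' z a b ha hb hab h =>
    Subtype.ext (funext fun y => h₁ y ha hb hab h)
  obtain ⟨g, hg⟩ := hφ'.exists_affineMap
  obtain ⟨σ, hσ⟩ := r.rangeRestrict.exists_rightInverse_of_surjective r.range_rangeRestrict
  refine ⟨σ.toAffineMap.comp g, fun x y => ?_⟩
  exact congrFun (congrArg Subtype.val ((LinearMap.congr_fun hσ (g x.1)).trans (hg x))) y

/-- The bilinear part of `G` uses the tensor coordinate, its two linear parts the other coordinates,
and `G 0 0` is the constant. -/
theorem _root_.AffineMap.exists_eq_tmul {V W : Type*} [AddCommGroup V] [Module ℝ V]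
    [AddCommGroup W] [Module ℝ W] (G : V →ᵃ[ℝ] (W →ᵃ[ℝ] F)) :
    ∃ g : (V ⊗[ℝ] W) × V × W →ᵃ[ℝ] F, ∀ x y, g (x ⊗ₜ[ℝ] y, x, y) = G x y := by
  let lin : (W →ᵃ[ℝ] F) →ₗ[ℝ] (W →ₗ[ℝ] F) :=
    { toFun := AffineMap.linear
      map_add' := fun _ _ => rfl
      map_smul' := fun _ _ => rfl }
  let ev : (W →ᵃ[ℝ] F) →ₗ[ℝ] F :=
    { toFun := fun h => h 0
      map_add' := fun _ _ => rfl
      map_smul' := fun _ _ => rfl }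
  let T : (V ⊗[ℝ] W) × V × W →ₗ[ℝ] F :=
    (TensorProduct.lift (lin ∘ₗ G.linear)).coprod ((ev ∘ₗ G.linear).coprod (G 0).linear)
  refine ⟨T.toAffineMap + AffineMap.const ℝ _ (G 0 0), fun x y => ?_⟩
  have e1 : G x = G.linear x + G 0 := congrFun G.decomp x
  have e2 : ∀ h : W →ᵃ[ℝ] F, h y = h.linear y + h 0 := fun h => congrFun h.decomp y
  have e3 : G x y = (G.linear x).linear y + (G.linear x) 0 + ((G 0).linear y + G 0 0) := by
    rw [e1, AffineMap.coe_add, Pi.add_apply, e2 (G.linear x), e2 (G 0)]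
  have e4 : T (x ⊗ₜ[ℝ] y, x, y) =
      (G.linear x).linear y + ((G.linear x) 0 + (G 0).linear y) := by
    simp only [T, LinearMap.coprod_apply, TensorProduct.lift.tmul]
    rfl
  change T _ + G 0 0 = _
  rw [e3, e4]
  abel

theorem exists_affineMap_of_biconvex (φ : P → Q → F)
    (h₁ : ∀ y, PreservesConvex fun x => φ x y) (h₂ : ∀ x, PreservesConvex (φ x)) :
    ∃ g : (P.E ⊗[ℝ] Q.E) × P.E × Q.E →ᵃ[ℝ] F,
      ∀ (x : P) (y : Q), g (x.1 ⊗ₜ[ℝ] y.1, x.1, y.1) = φ x y := by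
  obtain ⟨G, hG⟩ := exists_biaffineMap φ h₁ h₂
  obtain ⟨g, hg⟩ := G.exists_eq_tmul
  exact ⟨g, fun x y => (hg x.1 y.1).trans (hG x y)⟩

theorem lift_mem {φ : P → Q → R} {g : (P.E ⊗[ℝ] Q.E) × P.E × Q.E →ᵃ[ℝ] R.E}
    (hg : ∀ (x : P) (y : Q), g (x.1 ⊗ₜ[ℝ] y.1, x.1, y.1) = (φ x y).1) (w : tensor P Q) :
    g w.1 ∈ R.carrier := by
  have hw : w.1 ∈ convexHull ℝ (tensorGenerators P Q) := w.2
  refine convexHull_min (t := g ⁻¹' R.carrier) ?_ (R.convex_carrier.affine_preimage g) hw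
  rintro _ ⟨x, hx, y, hy, rfl⟩
  rw [Set.mem_preimage, hg ⟨x, hx⟩ ⟨y, hy⟩]
  exact (φ ⟨x, hx⟩ ⟨y, hy⟩).2

/-- The affine map on `P ⊗ Q` induced by a bi-affine map on `P × Q`. -/
noncomputable def lift (φ : P → Q → R) (h₁ : ∀ y, PreservesConvex fun x => (φ x y).1)
    (h₂ : ∀ x, PreservesConvex fun y => (φ x y).1) : tensor P Q ⟶ R :=
  let h := exists_affineMap_of_biconvex (fun x y => (φ x y).1) h₁ h₂
  Hom.mk (fun w => ⟨h.choose w.1, lift_mem h.choose_spec w⟩) ⟨h.choose, fun _ => rfl⟩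

@[simp]
theorem lift_tmul (φ : P → Q → R) (h₁ : ∀ y, PreservesConvex fun x => (φ x y).1)
    (h₂ : ∀ x, PreservesConvex fun y => (φ x y).1) (x : P) (y : Q) :
    (lift φ h₁ h₂).toFun (tmul x y) = φ x y :=
  Subtype.ext ((exists_affineMap_of_biconvex (fun x y => (φ x y).1) h₁ h₂).choose_spec x y)

end

end Pol

/-! ### Structure maps. -/

namespace Pol

section

variable {P Q R S P' Q' : Pol.{u}} {F : Type*} [AddCommGroup F] [Module ℝ F]

theorem PreservesConvex.smul_add_smul {φ ψ : P → F} (hφ : PreservesConvex φ)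
    (hψ : PreservesConvex ψ) (c d : ℝ) : PreservesConvex fun x => c • φ x + d • ψ x := by
  intro x y z a b ha hb hab h
  simp only [hφ ha hb hab h, hψ ha hb hab h]
  module

/-- For fixed parameters both sides are affine in `w`, so pure tensors suffice. This allows nested
lifts, as in the associator. -/
theorem preservesConvex_lift {φ : S → P → Q → R} (h₁ : ∀ s y, PreservesConvex fun x => (φ s x y).1)
    (h₂ : ∀ s x, PreservesConvex fun y => (φ s x y).1)
    (h₃ : ∀ x y, PreservesConvex fun s => (φ s x y).1) (w : tensor P Q) :
    PreservesConvex fun s => ((lift (φ s) (h₁ s) (h₂ s)).toFun w).1 := by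
  intro s s' t a b ha hb hab h
  refine PreservesConvex.eq_of_tmul
    (φ := fun w => ((lift (φ t) (h₁ t) (h₂ t)).toFun w).1)
    (ψ := fun w => a • ((lift (φ s) (h₁ s) (h₂ s)).toFun w).1 +
      b • ((lift (φ s') (h₁ s') (h₂ s')).toFun w).1)
    (preservesConvex_hom _)
    ((preservesConvex_hom _).smul_add_smul (preservesConvex_hom _) a b) (fun x y => ?_) w
  simp only [lift_tmul]
  exact h₃ x y ha hb hab h

/-- The tensor product of affine maps. -/
noncomputable def tensorMap (f : P ⟶ P') (g : Q ⟶ Q') : tensor P Q ⟶ tensor P' Q' :=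
  lift (fun x y => tmul (f.toFun x) (g.toFun y))
    (fun y => (preservesConvex_tmul_left (g.toFun y)).comp (preservesConvex_hom f))
    (fun x => (preservesConvex_tmul_right (f.toFun x)).comp (preservesConvex_hom g))

@[simp]
theorem tensorMap_tmul (f : P ⟶ P') (g : Q ⟶ Q') (x : P) (y : Q) :
    (tensorMap f g).toFun (tmul x y) = tmul (f.toFun x) (g.toFun y) :=
  lift_tmul ..

/-- The affine map `(P ⊗ Q) ⊗ R → P ⊗ (Q ⊗ R)` reassociating tensors. -/
noncomputable def assocHom (P Q R : Pol.{u}) : tensor (tensor P Q) R ⟶ tensor P (tensor Q R) :=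
  lift (fun w z => (lift (fun x y => tmul x (tmul y z))
      (fun y => preservesConvex_tmul_left (tmul y z))
      (fun x => (preservesConvex_tmul_right x).comp (preservesConvex_tmul_left z))).toFun w)
    (fun _ => preservesConvex_hom _)
    (fun w => preservesConvex_lift (φ := fun z x y => tmul x (tmul y z)) _ _
      (fun x y => (preservesConvex_tmul_right x).comp (preservesConvex_tmul_right y)) w)

@[simp]
theorem assocHom_tmul (x : P) (y : Q) (z : R) :
    (assocHom P Q R).toFun (tmul (tmul x y) z) = tmul x (tmul y z) := by
  simp [assocHom]

/-- The affine map `P ⊗ (Q ⊗ R) → (P ⊗ Q) ⊗ R` reassociating tensors. -/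
noncomputable def assocInv (P Q R : Pol.{u}) : tensor P (tensor Q R) ⟶ tensor (tensor P Q) R :=
  lift (fun x w => (lift (fun y z => tmul (tmul x y) z)
      (fun z => (preservesConvex_tmul_left z).comp (preservesConvex_tmul_right x))
      (fun y => preservesConvex_tmul_right (tmul x y))).toFun w)
    (fun w => preservesConvex_lift (φ := fun x y z => tmul (tmul x y) z) _ _
      (fun y z => (preservesConvex_tmul_left z).comp (preservesConvex_tmul_left y)) w)
    (fun _ => preservesConvex_hom _)

@[simp]
theorem assocInv_tmul (x : P) (y : Q) (z : R) :
    (assocInv P Q R).toFun (tmul x (tmul y z)) = tmul (tmul x y) z := by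
  simp [assocInv]

/-- The associator of polytopes. -/
noncomputable def assoc (P Q R : Pol.{u}) : tensor (tensor P Q) R ≅ tensor P (tensor Q R) where
  hom := assocHom P Q R
  inv := assocInv P Q R
  hom_inv_id := tensor_hom_ext_left fun x y z => by simp
  inv_hom_id := tensor_hom_ext_right fun x y z => by simp

/-- The left unitor of polytopes. -/
noncomputable def leftUnit (P : Pol.{u}) : tensor point P ≅ P where
  hom := lift (fun _ x => x) (fun x => preservesConvex_const x.1) (fun _ => preservesConvex_val)
  inv := homMk (fun x => tmul star x) (preservesConvex_tmul_right star)
  hom_inv_id := tensor_hom_ext fun _ x => by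
    simp only [comp_toFun, lift_tmul, homMk_toFun, id_toFun]
    -- Every point of `point` is `star` by eta.
    rfl
  inv_hom_id := hom_ext fun x => by simp

@[simp]
theorem leftUnit_hom_tmul (s : point.{u}) (x : P) : (leftUnit P).hom.toFun (tmul s x) = x :=
  lift_tmul _ (fun x => preservesConvex_const x.1) (fun _ => preservesConvex_val) s x

@[simp]
theorem leftUnit_inv_toFun (x : P) : (leftUnit P).inv.toFun x = tmul star x := rfl

/-- The right unitor of polytopes. -/
noncomputable def rightUnit (P : Pol.{u}) : tensor P point ≅ P where
  hom := lift (fun x _ => x) (fun _ => preservesConvex_val) (fun x => preservesConvex_const x.1)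
  inv := homMk (fun x => tmul x star) (preservesConvex_tmul_left star)
  hom_inv_id := tensor_hom_ext fun x _ => by
    simp only [comp_toFun, lift_tmul, homMk_toFun, id_toFun]
    rfl
  inv_hom_id := hom_ext fun x => by simp

@[simp]
theorem rightUnit_hom_tmul (x : P) (s : point.{u}) : (rightUnit P).hom.toFun (tmul x s) = x :=
  lift_tmul _ (fun _ => preservesConvex_val) (fun x => preservesConvex_const x.1) x s

@[simp]
theorem rightUnit_inv_toFun (x : P) : (rightUnit P).inv.toFun x = tmul x star := rfl

/-- The affine map `P ⊗ Q → Q ⊗ P` exchanging the factors. -/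
noncomputable def swapHom (P Q : Pol.{u}) : tensor P Q ⟶ tensor Q P :=
  lift (fun x y => tmul y x) preservesConvex_tmul_right preservesConvex_tmul_left

@[simp]
theorem swapHom_tmul (x : P) (y : Q) : (swapHom P Q).toFun (tmul x y) = tmul y x :=
  lift_tmul ..

@[simp]
theorem swapHom_comp_swapHom (P Q : Pol.{u}) : swapHom P Q ≫ swapHom Q P = 𝟙 (tensor P Q) :=
  tensor_hom_ext fun x y => by simp

/-- The symmetry of the tensor product of polytopes. -/
noncomputable def swap (P Q : Pol.{u}) : tensor P Q ≅ tensor Q P where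
  hom := swapHom P Q
  inv := swapHom Q P

/-- The hom-polytope. -/
abbrev homPol (P Q : Pol.{u}) : Pol.{u} := homPolytope P Q (isPolytope_homSet P Q)

/-- The point of the hom-polytope given by an affine map. -/
abbrev pointOf (f : P ⟶ Q) : homPol P Q := toPoint (isPolytope_homSet P Q) f

/-- The affine map given by a point of the hom-polytope. -/
noncomputable def ofPoint (φ : homPol P Q) : P ⟶ Q := Hom.mk (fun x => ⟨φ.1.1 x, φ.2 x⟩) φ.1.2

@[simp]
theorem pointOf_ofPoint (φ : homPol P Q) : pointOf (ofPoint φ) = φ := rfl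

@[simp]
theorem ofPoint_pointOf (f : P ⟶ Q) : ofPoint (pointOf f) = f := rfl

theorem preservesConvex_ofPoint (x : P) :
    PreservesConvex fun φ : homPol P Q => ((ofPoint φ).toFun x).1 :=
  fun _ _ _ _ _ _ _ _ h => congrFun (congrArg Subtype.val h) x

theorem preservesConvex_pointOf {f : R → (P ⟶ Q)}
    (h : ∀ x, PreservesConvex fun r => ((f r).toFun x).1) :
    PreservesConvex fun r => (pointOf (f r)).1 :=
  fun _ _ _ _ _ ha hb hab hz => Subtype.ext (funext fun x => h x ha hb hab hz)

/-- Composition with a fixed affine map, as a map of hom-polytopes. -/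
noncomputable def homMap (P : Pol.{u}) (g : Q ⟶ R) : homPol P Q ⟶ homPol P R :=
  homMk (fun φ => pointOf (ofPoint φ ≫ g))
    (preservesConvex_pointOf fun x => (preservesConvex_hom g).comp (preservesConvex_ofPoint x))

@[simp]
theorem homMap_toFun (g : Q ⟶ R) (φ : homPol P Q) :
    (homMap P g).toFun φ = pointOf (ofPoint φ ≫ g) := rfl

/-- The evaluation map `P ⊗ Hom(P, Q) → Q`. -/
noncomputable def eval (P Q : Pol.{u}) : tensor P (homPol P Q) ⟶ Q :=
  lift (fun x φ => (ofPoint φ).toFun x) (fun φ => preservesConvex_hom (ofPoint φ))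
    preservesConvex_ofPoint

@[simp]
theorem eval_tmul (x : P) (φ : homPol P Q) :
    (eval P Q).toFun (tmul x φ) = (ofPoint φ).toFun x :=
  lift_tmul ..

/-- The coevaluation map `Q → Hom(P, P ⊗ Q)`. -/
noncomputable def coeval (P Q : Pol.{u}) : Q ⟶ homPol P (tensor P Q) :=
  homMk (fun y => pointOf (homMk (fun x => tmul x y) (preservesConvex_tmul_left y)))
    (preservesConvex_pointOf preservesConvex_tmul_right)

@[simp]
theorem coeval_toFun (y : Q) : (coeval P Q).toFun y =
    pointOf (homMk (fun x => tmul x y) (preservesConvex_tmul_left y)) := rfl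

/-- The composition map `Hom(P, Q) ⊗ Hom(Q, R) → Hom(P, R)`. -/
noncomputable def compMap (P Q R : Pol.{u}) : tensor (homPol P Q) (homPol Q R) ⟶ homPol P R :=
  lift (fun φ ψ => pointOf (ofPoint φ ≫ ofPoint ψ))
    (fun ψ => preservesConvex_hom (homMap P (ofPoint ψ)))
    (fun φ => preservesConvex_pointOf fun x => preservesConvex_ofPoint ((ofPoint φ).toFun x))

@[simp]
theorem compMap_tmul (φ : homPol P Q) (ψ : homPol Q R) :
    (compMap P Q R).toFun (tmul φ ψ) = pointOf (ofPoint φ ≫ ofPoint ψ) :=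
  lift_tmul ..

/-- The affine map from the one-point polytope to a hom-polytope given by an affine map. -/
noncomputable def element (f : P ⟶ Q) : point ⟶ homPol P Q :=
  homMk (fun _ => pointOf f) (preservesConvex_const _)

@[simp]
theorem element_toFun (f : P ⟶ Q) (s : point.{u}) : (element f).toFun s = pointOf f := rfl

/-- Affine maps `P → Q` are the points of the hom-polytope. -/
noncomputable def elementEquiv (P Q : Pol.{u}) : (P ⟶ Q) ≃ (point ⟶ homPol P Q) where
  toFun := element
  invFun h := ofPoint (h.toFun star)
  left_inv _ := rfl
  right_inv _ := rfl

end

/-! ### Monoidal, symmetric, closed and enriched structures. -/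

section

/-- The tensor product of polytopes and its structure maps. -/
@[reducible]
noncomputable def monoidalCategoryStruct : MonoidalCategoryStruct Pol.{u} where
  tensorObj := tensor
  whiskerLeft P _ _ f := tensorMap (𝟙 P) f
  whiskerRight f P := tensorMap f (𝟙 P)
  tensorHom := tensorMap
  tensorUnit := point
  associator := assoc
  leftUnitor := leftUnit
  rightUnitor := rightUnit

attribute [local instance] monoidalCategoryStruct

/-- The monoidal category of polytopes. -/
@[reducible]
noncomputable def monoidalCategory : MonoidalCategory Pol.{u} := .ofTensorHom
  (id_tensorHom_id := fun P Q => tensor_hom_ext fun x y => tensorMap_tmul (𝟙 P) (𝟙 Q) x y)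
  (id_tensorHom := fun _ _ _ _ => rfl)
  (tensorHom_id := fun _ _ => rfl)
  (tensorHom_comp_tensorHom := fun f₁ f₂ g₁ g₂ => by
    change tensorMap f₁ f₂ ≫ tensorMap g₁ g₂ = tensorMap (f₁ ≫ g₁) (f₂ ≫ g₂)
    exact tensor_hom_ext fun x y => by simp)
  (associator_naturality := fun {X₁ X₂ X₃ Y₁ Y₂ Y₃} f₁ f₂ f₃ => by
    change tensorMap (tensorMap f₁ f₂) f₃ ≫ assocHom Y₁ Y₂ Y₃ =
      assocHom X₁ X₂ X₃ ≫ tensorMap f₁ (tensorMap f₂ f₃)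
    exact tensor_hom_ext_left fun x y z => by simp)
  (leftUnitor_naturality := fun {X Y} f => by
    change tensorMap (𝟙 point) f ≫ (leftUnit Y).hom = (leftUnit X).hom ≫ f
    exact tensor_hom_ext fun x y => by simp)
  (rightUnitor_naturality := fun {X Y} f => by
    change tensorMap f (𝟙 point) ≫ (rightUnit Y).hom = (rightUnit X).hom ≫ f
    exact tensor_hom_ext fun x y => by simp)
  (pentagon := fun W X Y Z => by
    change tensorMap (assocHom W X Y) (𝟙 Z) ≫ assocHom W (tensor X Y) Z ≫
      tensorMap (𝟙 W) (assocHom X Y Z) = assocHom (tensor W X) Y Z ≫ assocHom W X (tensor Y Z)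
    exact tensor_hom_ext_quadruple fun x y z w => by simp)
  (triangle := fun X Y => by
    change assocHom X point Y ≫ tensorMap (𝟙 X) (leftUnit Y).hom =
      tensorMap (rightUnit X).hom (𝟙 Y)
    exact tensor_hom_ext_left fun x y z => by simp)

attribute [local instance] monoidalCategory

/-- The symmetric monoidal category of polytopes. -/
@[reducible]
noncomputable def symmetricCategory : SymmetricCategory Pol.{u} where
  braiding := swap
  braiding_naturality_right X Y Z f := by
    change tensorMap (𝟙 X) f ≫ swapHom X Z = swapHom X Y ≫ tensorMap f (𝟙 X)
    exact tensor_hom_ext fun x y => by simp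
  braiding_naturality_left {X Y} f Z := by
    change tensorMap f (𝟙 Z) ≫ swapHom Y Z = swapHom X Z ≫ tensorMap (𝟙 Z) f
    exact tensor_hom_ext fun x y => by simp
  hexagon_forward X Y Z := by
    change assocHom X Y Z ≫ swapHom X (tensor Y Z) ≫ assocHom Y Z X =
      tensorMap (swapHom X Y) (𝟙 Z) ≫ assocHom Y X Z ≫ tensorMap (𝟙 Y) (swapHom X Z)
    exact tensor_hom_ext_left fun x y z => by simp
  hexagon_reverse X Y Z := by
    change assocInv X Y Z ≫ swapHom (tensor X Y) Z ≫ assocInv Z X Y =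
      tensorMap (𝟙 X) (swapHom Y Z) ≫ assocInv X Z Y ≫ tensorMap (swapHom X Z) (𝟙 Y)
    exact tensor_hom_ext_right fun x y z => by simp
  symmetry := swapHom_comp_swapHom

/-- The functor `Hom(P, -)`. -/
noncomputable def homFunctor (P : Pol.{u}) : Pol.{u} ⥤ Pol.{u} where
  obj Q := homPol P Q
  map g := homMap P g
  map_id _ := rfl
  map_comp _ _ := rfl

/-- The functor `Hom(P, -)` is right adjoint to `P ⊗ -`. -/
noncomputable def tensorHomAdjunction (P : Pol.{u}) : tensorLeft P ⊣ homFunctor P where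
  unit :=
    { app := fun Q => coeval P Q
      naturality := fun Q R g => by
        change g ≫ coeval P R = coeval P Q ≫ homMap P (tensorMap (𝟙 P) g)
        refine hom_ext fun y => congrArg pointOf (hom_ext fun x => ?_)
        simp }
  counit :=
    { app := fun Q => eval P Q
      naturality := fun Q R g => by
        change tensorMap (𝟙 P) (homMap P g) ≫ eval P R = eval P Q ≫ g
        exact tensor_hom_ext fun x φ => by simp }
  left_triangle_components Q := by
    change tensorMap (𝟙 P) (coeval P Q) ≫ eval P (tensor P Q) = 𝟙 (tensor P Q)
    exact tensor_hom_ext fun x y => by simp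
  right_triangle_components Q := by
    change coeval P (homPol P Q) ≫ homMap P (eval P Q) = 𝟙 (homPol P Q)
    refine hom_ext fun φ => ?_
    rw [id_toFun, ← pointOf_ofPoint φ]
    refine congrArg pointOf (hom_ext fun x => ?_)
    simp

/-- The closed monoidal category of polytopes. -/
@[reducible]
noncomputable def monoidalClosed : MonoidalClosed Pol.{u} where
  closed P := { rightAdj := homFunctor P, adj := tensorHomAdjunction P }

/-- The category of polytopes, enriched over itself. -/
@[reducible]
noncomputable def enrichedOrdinaryCategory : EnrichedOrdinaryCategory Pol.{u} Pol.{u} where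
  Hom := homPol
  id P := element (𝟙 P)
  comp := compMap
  id_comp P Q := by
    change (leftUnit (homPol P Q)).inv ≫ tensorMap (element (𝟙 P)) (𝟙 (homPol P Q)) ≫
      compMap P P Q = 𝟙 (homPol P Q)
    exact hom_ext fun φ => by simp
  comp_id P Q := by
    change (rightUnit (homPol P Q)).inv ≫ tensorMap (𝟙 (homPol P Q)) (element (𝟙 Q)) ≫
      compMap P Q Q = 𝟙 (homPol P Q)
    exact hom_ext fun φ => by simp
  assoc P Q R S := by
    change assocInv (homPol P Q) (homPol Q R) (homPol R S) ≫
      tensorMap (compMap P Q R) (𝟙 (homPol R S)) ≫ compMap P R S =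
      tensorMap (𝟙 (homPol P Q)) (compMap Q R S) ≫ compMap P Q S
    exact tensor_hom_ext_right fun φ ψ χ => by simp
  homEquiv := fun {P Q} => elementEquiv P Q
  homEquiv_id _ := rfl
  homEquiv_comp {P Q R} f g := by
    change element (f ≫ g) = (leftUnit point).inv ≫ tensorMap (element f) (element g) ≫
      compMap P Q R
    exact hom_ext fun s => by simp

end

end Pol

theorem mainTheorem5 :
    -- the sets of affine maps are polytopes
    ∃ hHom : ∀ P Q : Pol.{u}, IsPolytope (Pol.homSet P Q),
    -- a symmetric closed monoidal structure on the category of polytopes, with given unit,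
    -- tensor product and internal hom
    ∃ (_ : MonoidalCategory Pol.{u}) (_ : SymmetricCategory Pol.{u}) (_ : MonoidalClosed Pol.{u})
      (hunit : Pol.point.{u} = 𝟙_ Pol.{u})
      (htensor : ∀ P Q : Pol.{u}, Pol.tensor P Q = P ⊗ Q)
      (hihom : ∀ P Q : Pol.{u}, Pol.homPolytope P Q (hHom P Q) = (ihom P).obj Q),
    -- an enrichment of the category of polytopes over itself, with the hom-polytopes as hom-objects
    ∃ (_ : EnrichedOrdinaryCategory Pol.{u} Pol.{u})
      (henr : ∀ P Q : Pol.{u}, Pol.homPolytope P Q (hHom P Q) = EnrichedCategory.Hom P Q),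
    -- the point `*` of the unit, the universal bi-affine maps `P × Q → P ⊗ Q`, and the points
    -- of the two internal homs given by an affine map
    let pt : 𝟙_ Pol.{u} := Pol.cast hunit Pol.star
    let t : ∀ {P Q : Pol.{u}}, P → Q → (P ⊗ Q : Pol.{u}) :=
      fun {P Q} x y => Pol.cast (htensor P Q) (Pol.tmul x y)
    let i : ∀ {P Q : Pol.{u}}, (P ⟶ Q) → ((ihom P).obj Q : Pol.{u}) :=
      fun {P Q} f => Pol.cast (hihom P Q) (Pol.toPoint (hHom P Q) f)
    let e : ∀ {P Q : Pol.{u}}, (P ⟶ Q) → (EnrichedCategory.Hom P Q : Pol.{u}) :=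
      fun {P Q} f => Pol.cast (henr P Q) (Pol.toPoint (hHom P Q) f)
    -- the tensor product of affine maps
    (∀ {P P' Q Q' : Pol.{u}} (f : P ⟶ P') (g : Q ⟶ Q') (x : P) (y : Q),
      (f ⊗ₘ g).toFun (t x y) = t (f.toFun x) (g.toFun y)) ∧
    -- associator, unitors and braiding
    (∀ {P Q R : Pol.{u}} (x : P) (y : Q) (z : R),
      (α_ P Q R).hom.toFun (t (t x y) z) = t x (t y z)) ∧
    (∀ {P : Pol.{u}} (x : P), (λ_ P).hom.toFun (t pt x) = x) ∧
    (∀ {P : Pol.{u}} (x : P), (ρ_ P).hom.toFun (t x pt) = x) ∧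
    (∀ {P Q : Pol.{u}} (x : P) (y : Q), (β_ P Q).hom.toFun (t x y) = t y x) ∧
    -- the internal hom functor and the evaluation `P ⊗ Hom(P, Q) → Q`
    (∀ {P Q R : Pol.{u}} (f : P ⟶ Q) (g : Q ⟶ R), ((ihom P).map g).toFun (i f) = i (f ≫ g)) ∧
    (∀ {P Q : Pol.{u}} (x : P) (f : P ⟶ Q),
      ((ihom.ev P).app Q).toFun (t x (i f)) = f.toFun x) ∧
    -- identities, composition and underlying category of the enrichment
    (∀ P : Pol.{u}, (eId Pol.{u} P).toFun pt = e (𝟙 P)) ∧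
    (∀ {P Q R : Pol.{u}} (f : P ⟶ Q) (g : Q ⟶ R),
      (eComp Pol.{u} P Q R).toFun (t (e f) (e g)) = e (f ≫ g)) ∧
    (∀ {P Q : Pol.{u}} (f : P ⟶ Q), (eHomEquiv Pol.{u} f).toFun pt = e f) := by
  -- The structures use the prescribed objects definitionally, so the comparison equalities are
  -- `rfl` and every `Pol.cast` reduces to the identity.
  refine ⟨Pol.isPolytope_homSet, Pol.monoidalCategory, Pol.symmetricCategory, Pol.monoidalClosed, rfl,
    fun _ _ => rfl, fun _ _ => rfl, Pol.enrichedOrdinaryCategory, fun _ _ => rfl, ?_⟩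
  intro pt t i e
  exact ⟨Pol.tensorMap_tmul, Pol.assocHom_tmul, Pol.leftUnit_hom_tmul Pol.star,
    fun x => Pol.rightUnit_hom_tmul x Pol.star, Pol.swapHom_tmul, fun _ _ => rfl,
    fun x f => Pol.eval_tmul x (Pol.pointOf f), fun _ => rfl,
    fun f g => Pol.compMap_tmul (Pol.pointOf f) (Pol.pointOf g), fun _ => rfl⟩
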